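/- Let $\mathcal H$ be a complex Hilbert space and let $A$ be a bounded linear operator on $\mathcal H$ that is subnormal, i.e. there exist a complex Hilbert space $\mathcal G$ and bounded linear operators $B\colon\mathcal G\to\mathcal H$, $C\colon\mathcal G\to\mathcal G$ such that the operator $$N=\begin{bmatrix} A & B\\ 0 & C\end{bmatrix}\colon \mathcal H\oplus\mathcal G\to\mathcal H\oplus\mathcal G$$ is normal. Let $W_0(A)$ be the maximal numerical range of $A$, that is, the set of all $\lambda\in\mathbb C$ for which there is a sequence $(x_n)$ in $\mathcal H$ with $\|x_n\|=1$ for all $n$, $\|Ax_n\|\to\|A\|$ and $\langle Ax_n,x_n\rangle\to\lambda$; let $\sigma(A)$ be the spectrum of $A$ and let $\mathcal C_A=\{z\in\mathbb C: |z|=\|A\|\}$. Then $$W_0(A)=\operatorname{conv}\bigl(\sigma(A)\cap\mathcal C_A\bigr),$$ where $\operatorname{conv}$ denotes the convex hull. -/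

import Mathlib

universe u v

/-- The maximal numerical range `W₀(A)`. Mathlib's inner product is linear in its second
argument, so `inner ℂ x (A x)` is the scalar usually written `⟨A x, x⟩`. -/
def maximalNumericalRange {H : Type u} [NormedAddCommGroup H] [InnerProductSpace ℂ H]
    (A : H →L[ℂ] H) : Set ℂ :=
  {l | ∃ x : ℕ → H, (∀ n, ‖x n‖ = 1) ∧
    Filter.Tendsto (fun n => ‖A (x n)‖) Filter.atTop (nhds ‖A‖) ∧
    Filter.Tendsto (fun n => inner ℂ (x n) (A (x n))) Filter.atTop (nhds l)}

/-- The circle `C_A` of all complex numbers of modulus `‖A‖`. -/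
def normCircle {H : Type u} [NormedAddCommGroup H] [InnerProductSpace ℂ H]
    (A : H →L[ℂ] H) : Set ℂ :=
  {z | ‖z‖ = ‖A‖}

/-- The block operator `[A B; 0 C]` on the Hilbert space direct sum `H ⊕ G`. -/
noncomputable def upperBlockOperator {H : Type u} [NormedAddCommGroup H] [InnerProductSpace ℂ H]
    {G : Type v} [NormedAddCommGroup G] [InnerProductSpace ℂ G]
    (A : H →L[ℂ] H) (B : G →L[ℂ] H) (C : G →L[ℂ] G) :
    WithLp 2 (H × G) →L[ℂ] WithLp 2 (H × G) :=
  (WithLp.prodContinuousLinearEquiv 2 ℂ H G).symm.toContinuousLinearMap ∘L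
    ((A ∘L ContinuousLinearMap.fst ℂ H G + B ∘L ContinuousLinearMap.snd ℂ H G).prod
      (C ∘L ContinuousLinearMap.snd ℂ H G)) ∘L
    (WithLp.prodContinuousLinearEquiv 2 ℂ H G).toContinuousLinearMap

theorem upperBlockOperator_apply {H : Type u} [NormedAddCommGroup H] [InnerProductSpace ℂ H]
    {G : Type v} [NormedAddCommGroup G] [InnerProductSpace ℂ G]
    (A : H →L[ℂ] H) (B : G →L[ℂ] H) (C : G →L[ℂ] G) (p : WithLp 2 (H × G)) :
    upperBlockOperator A B C p = WithLp.toLp 2 (A p.fst + B p.snd, C p.snd) := rfl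

/-- `A` is subnormal: some block operator `[A B; 0 C]` on a Hilbert space direct sum `H ⊕ G`
is normal. The universe of the Hilbert space `G` is a free parameter. -/
def IsSubnormal {H : Type u} [NormedAddCommGroup H] [InnerProductSpace ℂ H] [CompleteSpace H]
    (A : H →L[ℂ] H) : Prop :=
  ∃ (G : Type v) (_ : NormedAddCommGroup G) (_ : InnerProductSpace ℂ G) (_ : CompleteSpace G)
    (B : G →L[ℂ] H) (C : G →L[ℂ] G), IsStarNormal (upperBlockOperator A B C)

open Filter Topology
open scoped ComplexConjugate

/-! The inclusion ⊇ holds for every operator. A spectral value z with |z| = ‖A‖ is an approximate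
eigenvalue, and its approximate eigenvectors also serve A* and z̄ (`norm_adjoint_sub_smul_sq_le`).
For distinct values they are therefore asymptotically orthogonal, so combining them with square
roots of convex weights realizes any convex combination.

For ⊆, suppose a line separates l from the hull: φ l < u < φ on the hull. For large M, M(‖A‖² -
|w|²) + φ w - u is nonnegative on σ(A). On H, the functional calculus of a normal extension N sees
only σ(A) (`mem_cfcAnnihilator_of_eqOn_spectrum`), even if σ(N) is larger. Hence M(‖A‖²‖h‖² - ‖Ah‖²)
+ φ⟨Ah,h⟩ - u‖h‖² ≥ 0 on H, and a sequence defining l gives φ l ≥ u in the limit. -/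

/-- The convex hull of a compact set in a finite-dimensional real normed space is compact. -/
theorem IsCompact.convexHull_of_finiteDimensional {E : Type*} [NormedAddCommGroup E]
    [NormedSpace ℝ E] [FiniteDimensional ℝ E] {s : Set E} (hs : IsCompact s) :
    IsCompact (convexHull ℝ s) := by
  -- By Carathéodory, finitely many numbers of points suffice, so the hull is a finite union of
  -- continuous images of compact sets.
  have key : convexHull ℝ s = ⋃ k ∈ Finset.range (Module.finrank ℝ E + 2),
      (fun p : (Fin k → ℝ) × (Fin k → E) => ∑ i, p.1 i • p.2 i) ''
        (stdSimplex ℝ (Fin k) ×ˢ Set.univ.pi fun _ => s) := by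
    apply Set.Subset.antisymm
    · intro x hx
      obtain ⟨ι, _, z, w, hz, hind, hw, hw1, rfl⟩ := eq_pos_convex_span_of_mem_convexHull hx
      have hcard : Fintype.card ι ≤ Module.finrank ℝ E + 1 :=
        hind.card_le_finrank_succ.trans (Nat.succ_le_succ (Submodule.finrank_le _))
      let e := Fintype.equivFin ι
      refine Set.mem_biUnion (Finset.mem_coe.2 (Finset.mem_range.2 (Nat.lt_succ_of_le hcard)))
        ⟨(w ∘ e.symm, z ∘ e.symm), ⟨⟨fun i => (hw _).le, ?_⟩, fun i _ => hz ⟨_, rfl⟩⟩, ?_⟩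
      · rw [← hw1]; exact e.symm.sum_comp w
      · exact e.symm.sum_comp fun i => w i • z i
    · refine Set.iUnion₂_subset fun k _ => ?_
      rintro _ ⟨⟨w, z⟩, ⟨⟨hw, hw1⟩, hz⟩, rfl⟩
      exact (convex_convexHull ℝ s).sum_mem (fun i _ => hw i) hw1
        fun i _ => subset_convexHull ℝ s (hz i trivial)
  rw [key]
  refine (Finset.range _).isCompact_biUnion fun k _ => ?_
  exact ((isCompact_stdSimplex ℝ (Fin k)).prod (isCompact_univ_pi fun _ => hs)).image (by fun_prop)

/-! ### Spectral values of maximal modulus and their convex combinations -/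

section Hilbert

variable {H : Type*} [NormedAddCommGroup H] [InnerProductSpace ℂ H]

/-- An eigenvalue of maximal modulus is almost an eigenvalue of the adjoint, with the same
approximate eigenvectors. -/
theorem norm_adjoint_sub_smul_sq_le [CompleteSpace H] (A : H →L[ℂ] H) {z : ℂ} (hz : ‖z‖ = ‖A‖)
    (x : H) :
    ‖ContinuousLinearMap.adjoint A x - conj z • x‖ ^ 2 ≤ 2 * ‖A‖ * ‖x‖ * ‖A x - z • x‖ := by
  have h1 : ‖ContinuousLinearMap.adjoint A x‖ ≤ ‖A‖ * ‖x‖ := by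
    simpa using (ContinuousLinearMap.adjoint A).le_opNorm x
  have h2 : ‖conj z • x‖ = ‖A‖ * ‖x‖ := by rw [norm_smul, RCLike.norm_conj, hz]
  -- Since |z| = ‖A‖, the cross term cancels the two squares up to an error linear in Ax - zx.
  have h3 : inner ℂ (ContinuousLinearMap.adjoint A x) (conj z • x)
      = inner ℂ (z • x) (A x - z • x) + ((‖A‖ * ‖x‖) ^ 2 : ℝ) := by
    have h4 : (z * conj z) = ((‖A‖ ^ 2 : ℝ) : ℂ) := by
      rw [RCLike.mul_conj, hz]; norm_cast
    rw [inner_smul_right, ContinuousLinearMap.adjoint_inner_left, inner_sub_right, inner_smul_left,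
      inner_smul_left, inner_smul_right, inner_self_eq_norm_sq_to_K]
    push_cast at h4 ⊢
    linear_combination (‖x‖ : ℂ) ^ 2 * h4
  have h5 : -(‖A‖ * ‖x‖ * ‖A x - z • x‖) ≤ (inner ℂ (z • x) (A x - z • x)).re := by
    have := (Complex.abs_re_le_norm _).trans (norm_inner_le_norm (𝕜 := ℂ) (z • x) (A x - z • x))
    rw [norm_smul, hz] at this
    exact (abs_le.1 this).1
  rw [@norm_sub_sq ℂ, h3, h2]
  simp only [map_add, RCLike.re_eq_complex_re, Complex.ofReal_re]
  have h6 : ‖ContinuousLinearMap.adjoint A x‖ ^ 2 ≤ (‖A‖ * ‖x‖) ^ 2 := by gcongr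
  linarith

/-- The lower bound makes the range closed and T injective; the trivial kernel of T* makes the range
dense. -/
theorem ContinuousLinearMap.isUnit_of_bounded_below_of_ker_adjoint [CompleteSpace H]
    (T : H →L[ℂ] H) {c : ℝ} (hc : 0 < c) (hT : ∀ x, c * ‖x‖ ≤ ‖T x‖)
    (hT' : ∀ y, ContinuousLinearMap.adjoint T y = 0 → y = 0) : IsUnit T := by
  have hanti : AntilipschitzWith (c.toNNReal⁻¹ : NNReal) T := by
    refine AddMonoidHomClass.antilipschitz_of_bound T fun x => ?_
    rw [NNReal.coe_inv, Real.coe_toNNReal c hc.le, inv_mul_eq_div, le_div_iff₀ hc, mul_comm]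
    exact hT x
  have hclosed : IsClosed (T.range : Set H) := by
    exact hanti.isClosed_range T.uniformContinuous
  rw [ContinuousLinearMap.isUnit_iff_bijective]
  refine ⟨hanti.injective, ?_⟩
  have : CompleteSpace T.range := hclosed.completeSpace_coe
  have hbot : T.rangeᗮ = ⊥ := by
    rw [T.orthogonal_range]
    exact (Submodule.eq_bot_iff _).2 fun y hy => hT' y hy
  have htop := Submodule.orthogonal_eq_bot_iff.1 hbot
  exact LinearMap.range_eq_top.1 htop

/-- Spectral values of maximal modulus are approximate eigenvalues. -/
theorem exists_norm_eq_one_norm_sub_smul_lt [CompleteSpace H] (A : H →L[ℂ] H) {z : ℂ}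
    (hzA : z ∈ spectrum ℂ A) (hz : ‖z‖ = ‖A‖) {ε : ℝ} (hε : 0 < ε) :
    ∃ x : H, ‖x‖ = 1 ∧ ‖A x - z • x‖ < ε := by
  by_contra! hcon
  have hbelow : ∀ x : H, ε * ‖x‖ ≤ ‖A x - z • x‖ := by
    intro x
    rcases eq_or_ne x 0 with rfl | hx
    · simp
    have hx' : 0 < ‖x‖ := norm_pos_iff.2 hx
    have h := hcon (((‖x‖⁻¹ : ℝ) : ℂ) • x) (by simp [norm_smul, hx'.ne'])
    rw [map_smul, smul_comm z, ← smul_sub, norm_smul, Complex.norm_real, norm_inv, norm_norm,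
      inv_mul_eq_div, le_div_iff₀ hx'] at h
    exact h
  refine hzA ?_
  rw [spectrum.mem_resolventSet_iff, ← neg_sub, IsUnit.neg_iff]
  refine ContinuousLinearMap.isUnit_of_bounded_below_of_ker_adjoint _ hε
    (fun x => by simpa [Algebra.algebraMap_eq_smul_one] using hbelow x) fun y hy => ?_
  -- The same estimate for A* shows that a vector killed by A* - z̄ is killed by A - z, hence zero.
  have hA' : ‖conj z‖ = ‖ContinuousLinearMap.adjoint A‖ := by simpa using hz
  have h0 : ContinuousLinearMap.adjoint A y - conj z • y = 0 := by
    rw [← ContinuousLinearMap.star_eq_adjoint] at hy ⊢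
    simpa [Algebra.algebraMap_eq_smul_one] using hy
  have h1 := norm_adjoint_sub_smul_sq_le (ContinuousLinearMap.adjoint A) hA' y
  rw [h0, norm_zero, mul_zero, ContinuousLinearMap.adjoint_adjoint, Complex.conj_conj] at h1
  have h2 : ‖A y - z • y‖ = 0 := by
    simpa using le_antisymm h1 (sq_nonneg _)
  have h3 := hbelow y
  rw [h2] at h3
  exact norm_eq_zero.1 (le_antisymm (by nlinarith) (norm_nonneg y))

theorem mem_maximalNumericalRange_of_tendsto (A : H →L[ℂ] H) {l : ℂ} (z : ℕ → H)
    (h1 : Tendsto (fun n => ‖z n‖) atTop (𝓝 1))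
    (h2 : Tendsto (fun n => ‖A (z n)‖) atTop (𝓝 ‖A‖))
    (h3 : Tendsto (fun n => inner ℂ (z n) (A (z n))) atTop (𝓝 l)) :
    l ∈ maximalNumericalRange A := by
  obtain ⟨N, hN⟩ := eventually_atTop.1 (h1.eventually_ne one_ne_zero)
  have hs := tendsto_add_atTop_nat N
  have hi : Tendsto (fun n => ‖z (n + N)‖⁻¹) atTop (𝓝 1) := by
    simpa using (h1.comp hs).inv₀ one_ne_zero
  refine ⟨fun n => ((‖z (n + N)‖⁻¹ : ℝ) : ℂ) • z (n + N), fun n => ?_, ?_, ?_⟩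
  · have := hN (n + N) (Nat.le_add_left _ _)
    simp [norm_smul, this]
  · simpa [norm_smul] using hi.mul (h2.comp hs)
  · have hc : Tendsto (fun n => ((‖z (n + N)‖⁻¹ : ℝ) : ℂ)) atTop (𝓝 1) := by
      simpa only [Complex.ofReal_one] using! (Complex.continuous_ofReal.tendsto 1).comp hi
    have := hc.mul (hc.mul (h3.comp hs))
    simp only [one_mul] at this
    refine this.congr fun n => ?_
    rw [map_smul, inner_smul_left, inner_smul_right, Complex.conj_ofReal]
    rfl

/-- The convex hull of the spectral values of maximal modulus is contained in the maximal numerical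
range, for every operator. -/
theorem convexHull_spectrum_inter_normCircle_subset [CompleteSpace H] (A : H →L[ℂ] H) :
    convexHull ℝ (spectrum ℂ A ∩ normCircle A) ⊆ maximalNumericalRange A := by
  classical
  intro l hl
  rw [convexHull_eq_union_convexHull_finite_subsets] at hl
  simp only [Set.mem_iUnion] at hl
  obtain ⟨t, hts, hlt⟩ := hl
  obtain ⟨w, hw, hw1, rfl⟩ := Finset.mem_convexHull'.1 hlt
  have hex : ∀ (p : ℂ) (n : ℕ), ∃ x : H,
      p ∈ t → ‖x‖ = 1 ∧ ‖A x - p • x‖ < 1 / ((n : ℝ) + 1) := by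
    intro p n
    by_cases hp : p ∈ t
    · obtain ⟨x, hx⟩ := exists_norm_eq_one_norm_sub_smul_lt A (hts hp).1 (hts hp).2
        (Nat.one_div_pos_of_nat (α := ℝ) (n := n))
      exact ⟨x, fun _ => hx⟩
    · exact ⟨0, fun h => absurd h hp⟩
  choose x hx using hex
  have herr : ∀ p ∈ t, Tendsto (fun n => A (x p n) - p • x p n) atTop (𝓝 0) := fun p hp =>
    squeeze_zero_norm (fun n => (hx p n hp).2.le) tendsto_one_div_add_atTop_nhds_zero_nat
  have hinner_zero : ∀ (u v : ℕ → H), (∃ c, ∀ n, ‖u n‖ ≤ c) → Tendsto v atTop (𝓝 0) →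
      Tendsto (fun n => inner ℂ (u n) (v n)) atTop (𝓝 0) := by
    rintro u v ⟨c, hc⟩ hv
    refine squeeze_zero_norm (a := fun n => c * ‖v n‖) (fun n => ?_) ?_
    · exact (norm_inner_le_norm _ _).trans (mul_le_mul_of_nonneg_right (hc n) (norm_nonneg _))
    · simpa using (tendsto_zero_iff_norm_tendsto_zero.1 hv).const_mul c
  have hbdd : ∀ p ∈ t, ∃ c, ∀ n, ‖x p n‖ ≤ c := fun p hp => ⟨1, fun n => (hx p n hp).1.le⟩
  have herr' : ∀ p ∈ t,
      Tendsto (fun n => ContinuousLinearMap.adjoint A (x p n) - conj p • x p n) atTop (𝓝 0) := by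
    intro p hp
    have h1 : Tendsto (fun n => 2 * ‖A‖ * ‖A (x p n) - p • x p n‖) atTop (𝓝 0) := by
      simpa using (tendsto_zero_iff_norm_tendsto_zero.1 (herr p hp)).const_mul (2 * ‖A‖)
    have h2 := squeeze_zero (fun n => sq_nonneg _) (fun n => by
      have := norm_adjoint_sub_smul_sq_le A (hts hp).2 (x p n)
      rwa [(hx p n hp).1, mul_one] at this) h1
    rw [tendsto_zero_iff_norm_tendsto_zero]
    simpa using h2.sqrt
  -- The Gram matrix of the approximate eigenvectors tends to the identity.
  have hgram : ∀ p ∈ t, ∀ q ∈ t,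
      Tendsto (fun n => inner ℂ (x p n) (x q n)) atTop (𝓝 (if p = q then 1 else 0)) := by
    intro p hp q hq
    split_ifs with h
    · subst h
      refine tendsto_const_nhds.congr fun n => ?_
      rw [inner_self_eq_norm_sq_to_K, (hx p n hp).1]; simp
    · have h1 := hinner_zero _ _ (hbdd p hp) (herr q hq)
      have h2 := hinner_zero _ _ (hbdd q hq) (herr' p hp)
      have h2' := (Complex.continuous_conj.tendsto 0).comp h2
      rw [map_zero] at h2'
      -- The difference of the two errors is exactly (q - p)⟨x_p, x_q⟩.
      have h3 := ((h2'.sub h1).const_mul (q - p)⁻¹)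
      simp only [sub_zero, mul_zero] at h3
      refine h3.congr fun n => ?_
      have hqp : q - p ≠ 0 := sub_ne_zero.2 (Ne.symm h)
      rw [Function.comp_apply, inner_conj_symm]
      simp only [inner_sub_left, inner_sub_right, inner_smul_left, inner_smul_right,
        ContinuousLinearMap.adjoint_inner_left, Complex.conj_conj]
      field_simp
      ring
  have hgramA : ∀ p ∈ t, ∀ q ∈ t,
      Tendsto (fun n => inner ℂ (x p n) (A (x q n))) atTop (𝓝 (if p = q then q else 0)) := by
    intro p hp q hq
    have := (hinner_zero _ _ (hbdd p hp) (herr q hq)).add ((hgram p hp q hq).const_mul q)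
    rw [zero_add, mul_ite, mul_one, mul_zero] at this
    refine this.congr fun n => ?_
    rw [inner_sub_right, inner_smul_right]; ring
  have hgramAA : ∀ p ∈ t, ∀ q ∈ t, Tendsto (fun n => inner ℂ (A (x p n)) (A (x q n))) atTop
      (𝓝 (if p = q then ((‖A‖ ^ 2 : ℝ) : ℂ) else 0)) := by
    intro p hp q hq
    have hb : ∃ c, ∀ n, ‖A (x q n)‖ ≤ c :=
      ⟨‖A‖, fun n => by simpa [(hx q n hq).1] using A.le_opNorm (x q n)⟩
    have h1 := (Complex.continuous_conj.tendsto 0).comp (hinner_zero _ _ hb (herr p hp))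
    have := h1.add ((hgramA p hp q hq).const_mul (conj p))
    rw [map_zero, zero_add, mul_ite, mul_zero] at this
    have hval : (if p = q then conj p * q else 0)
        = if p = q then ((‖A‖ ^ 2 : ℝ) : ℂ) else 0 := by
      split_ifs with h
      · subst h
        rw [RCLike.conj_mul, (hts hp).2]; norm_cast
      · rfl
    rw [hval] at this
    refine this.congr fun n => ?_
    simp only [Function.comp_apply, inner_conj_symm, inner_sub_left, inner_smul_left]; ring
  let s : ℂ → ℂ := fun p => (Real.sqrt (w p) : ℂ)
  have hs : ∀ p ∈ t, s p * s p = w p := fun p hp => by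
    rw [← Complex.ofReal_mul, Real.mul_self_sqrt (hw p hp)]
  let z : ℕ → H := fun n => ∑ p ∈ t, s p • x p n
  have hsum : ∀ (u v : ℂ → ℕ → H) (f : ℂ → ℂ),
      (∀ p ∈ t, ∀ q ∈ t,
        Tendsto (fun n => inner ℂ (u p n) (v q n)) atTop (𝓝 (if p = q then f q else 0))) →
      Tendsto (fun n => inner ℂ (∑ p ∈ t, s p • u p n) (∑ q ∈ t, s q • v q n)) atTop
        (𝓝 (∑ p ∈ t, (w p : ℂ) * f p)) := by
    intro u v f huv
    have h1 := tendsto_finsetSum t fun p hp => tendsto_finsetSum t fun q hq =>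
      (huv p hp q hq).const_mul (s p * s q)
    have h2 : ∑ p ∈ t, ∑ q ∈ t, s p * s q * (if p = q then f q else 0)
        = ∑ p ∈ t, (w p : ℂ) * f p := by
      refine Finset.sum_congr rfl fun p hp => ?_
      simp [hp, hs p hp]
    rw [h2] at h1
    refine h1.congr fun n => ?_
    simp only [sum_inner, inner_sum, inner_smul_left, inner_smul_right, s, Complex.conj_ofReal,
      Finset.mul_sum]
    rw [Finset.sum_comm]
    exact Finset.sum_congr rfl fun p _ => Finset.sum_congr rfl fun q _ => by ring
  have hAz : ∀ n, A (z n) = ∑ p ∈ t, s p • A (x p n) := fun n => by simp [z, map_sum]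
  have hw1' : ∑ p ∈ t, (w p : ℂ) = 1 := by exact_mod_cast hw1
  have hnorm : ∀ (y : ℕ → H) (r : ℝ), 0 ≤ r →
      Tendsto (fun n => inner ℂ (y n) (y n)) atTop (𝓝 ((r ^ 2 : ℝ) : ℂ)) →
      Tendsto (fun n => ‖y n‖) atTop (𝓝 r) := by
    intro y r hr hy
    have h1 := ((Complex.continuous_re.tendsto _).comp hy).sqrt
    rw [Complex.ofReal_re, Real.sqrt_sq hr] at h1
    refine h1.congr fun n => ?_
    rw [Function.comp_apply, norm_eq_sqrt_re_inner (𝕜 := ℂ)]; rfl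
  refine mem_maximalNumericalRange_of_tendsto A z ?_ ?_ ?_
  · refine hnorm z 1 zero_le_one ?_
    simpa [hw1'] using hsum x x (fun _ => 1) hgram
  · refine hnorm _ _ (norm_nonneg A) ?_
    have := hsum (fun p n => A (x p n)) (fun p n => A (x p n)) _ hgramAA
    rw [← Finset.sum_mul, hw1', one_mul] at this
    exact this.congr fun n => by rw [hAz]
  · have := hsum x (fun p n => A (x p n)) (fun p => p) hgramA
    simp only [Complex.real_smul]
    exact this.congr fun n => by rw [hAz]

end Hilbert

/-! ### Functional calculus of a normal extension -/

section NormalExtension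

variable {H : Type*} [NormedAddCommGroup H] [InnerProductSpace ℂ H]
  {K : Type*} [NormedAddCommGroup K] [InnerProductSpace ℂ K] [CompleteSpace K]

/-- The ideal of continuous functions `f` on the spectrum of a normal operator `N` such that
`f(N)` vanishes on the range of `V`. -/
noncomputable def cfcAnnihilator {N : K →L[ℂ] K} (hN : IsStarNormal N) (V : H →L[ℂ] K) :
    Ideal C(spectrum ℂ N, ℂ) where
  carrier := {f | ∀ h, cfcHom hN f (V h) = 0}
  add_mem' hf hg h := by simp [hf h, hg h]
  zero_mem' h := by simp
  smul_mem' g f hf h := by simp [hf h]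

theorem isClosed_cfcAnnihilator {N : K →L[ℂ] K} (hN : IsStarNormal N) (V : H →L[ℂ] K) :
    IsClosed (cfcAnnihilator hN V : Set C(spectrum ℂ N, ℂ)) := by
  have : (cfcAnnihilator hN V : Set C(spectrum ℂ N, ℂ))
      = ⋂ h, {f | cfcHom hN f (V h) = 0} := by
    ext f; simp [cfcAnnihilator]
  rw [this]
  refine isClosed_iInter fun h => isClosed_eq ?_ continuous_const
  exact (ContinuousLinearMap.apply ℂ K (V h)).continuous.comp (cfcHom_continuous hN)

/-- If `N` extends `A`, then a function of `N` supported near a point of the resolvent set of `A`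
vanishes on the range of the embedding. -/
theorem mem_cfcAnnihilator_of_support {A : H →L[ℂ] H} {N : K →L[ℂ] K} (hN : IsStarNormal N)
    (V : H →L[ℂ] K) (hV : ∀ h, N (V h) = V (A h)) {z : ℂ} {R : H →L[ℂ] H}
    (hR : ∀ h, A (R h) - z • R h = h) (f : C(spectrum ℂ N, ℂ))
    (hf : ∀ w, f w ≠ 0 → ‖(w : ℂ) - z‖ * ‖R‖ ≤ 1 / 2) : f ∈ cfcAnnihilator hN V := by
  intro h
  let g : C(spectrum ℂ N, ℂ) := (ContinuousMap.id ℂ).restrict (spectrum ℂ N) - algebraMap ℂ _ z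
  have hg : cfcHom hN g = N - algebraMap ℂ _ z := by
    rw [map_sub, cfcHom_id, AlgHomClass.commutes]
  -- With R = (A - z)⁻¹, each factor N - z undoes one R. On the support of f, |w - z|‖R‖ ≤ 1/2, so
  -- f(N)V h = O(2⁻ⁿ).
  have hpow : ∀ n : ℕ, V h = cfcHom hN (g ^ n) (V ((R ^ n) h)) := by
    intro n
    induction n with
    | zero => simp
    | succ n ih =>
      rw [pow_succ g, pow_succ' R, map_mul, hg]
      simp only [mul_apply_eq_comp, sub_apply, hV]
      rw [Algebra.algebraMap_eq_smul_one, smul_apply,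
        one_apply_eq_self, ← map_smul V, ← map_sub V, hR]
      exact ih
  have hbound : ∀ n : ℕ, ‖cfcHom hN f (V h)‖ ≤ ‖f‖ * ‖V‖ * ‖h‖ * (1 / 2) ^ n := by
    intro n
    have hnorm : ‖f * g ^ n‖ * ‖R‖ ^ n ≤ ‖f‖ * (1 / 2) ^ n := by
      rw [← Real.norm_of_nonneg (pow_nonneg (norm_nonneg R) n), mul_comm, ← norm_smul,
        ContinuousMap.norm_le _ (by positivity)]
      intro w
      by_cases hw : f w = 0
      · simp only [ContinuousMap.smul_apply, ContinuousMap.mul_apply, hw, zero_mul, smul_zero,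
          norm_zero]
        positivity
      · have hgw : g w = (w : ℂ) - z := rfl
        rw [ContinuousMap.smul_apply, ContinuousMap.mul_apply, ContinuousMap.pow_apply, hgw,
          norm_smul, norm_mul, norm_pow, norm_pow, norm_norm]
        calc ‖R‖ ^ n * (‖f w‖ * ‖(w : ℂ) - z‖ ^ n) = ‖f w‖ * (‖(w : ℂ) - z‖ * ‖R‖) ^ n := by
              rw [mul_pow]; ring
          _ ≤ ‖f‖ * (1 / 2) ^ n := by
              gcongr
              · exact f.norm_coe_le_norm w
              · exact hf w hw
    have hRn : ‖(R ^ n) h‖ ≤ ‖R‖ ^ n * ‖h‖ := by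
      clear hnorm
      induction n with
      | zero => simp
      | succ n ih =>
        rw [pow_succ', pow_succ', mul_apply_eq_comp, mul_assoc]
        exact (R.le_opNorm _).trans (by gcongr)
    calc ‖cfcHom hN f (V h)‖ = ‖cfcHom hN (f * g ^ n) (V ((R ^ n) h))‖ := by
          rw [map_mul, mul_apply_eq_comp, ← hpow n]
      _ ≤ ‖cfcHom hN (f * g ^ n)‖ * (‖V‖ * (‖R‖ ^ n * ‖h‖)) := by
          refine (ContinuousLinearMap.le_opNorm _ _).trans ?_
          gcongr
          exact (V.le_opNorm _).trans (by gcongr)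
      _ = ‖f * g ^ n‖ * ‖R‖ ^ n * (‖V‖ * ‖h‖) := by
          rw [(isometry_cfcHom N hN).norm_map_of_map_zero (map_zero _)]; ring
      _ ≤ ‖f‖ * (1 / 2) ^ n * (‖V‖ * ‖h‖) := by gcongr
      _ = _ := by ring
  have hlim : Tendsto (fun n : ℕ => ‖f‖ * ‖V‖ * ‖h‖ * (1 / 2 : ℝ) ^ n) atTop (𝓝 0) := by
    simpa using (tendsto_pow_atTop_nhds_zero_of_lt_one (r := (1 / 2 : ℝ)) (by norm_num)
      (by norm_num)).const_mul (‖f‖ * ‖V‖ * ‖h‖)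
  exact norm_le_zero_iff.1 (ge_of_tendsto' hlim hbound)

/-- If the normal operator `N` extends `A`, then a function of `N` that vanishes on the spectrum of
`A` vanishes on the space on which `A` acts. -/
theorem mem_cfcAnnihilator_of_eqOn_spectrum {A : H →L[ℂ] H} {N : K →L[ℂ] K}
    (hN : IsStarNormal N) (V : H →L[ℂ] K) (hV : ∀ h, N (V h) = V (A h))
    (f : C(spectrum ℂ N, ℂ)) (hf : ∀ w : spectrum ℂ N, (w : ℂ) ∈ spectrum ℂ A → f w = 0) :
    f ∈ cfcAnnihilator hN V := by
  -- A closed ideal consists of all functions vanishing on its zero set, so each point off σ(A) only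
  -- needs one member nonzero there: the bump `f₀`.
  rw [← ContinuousMap.idealOfSet_ofIdeal_isClosed (isClosed_cfcAnnihilator hN V),
    ContinuousMap.mem_idealOfSet]
  intro z hz
  refine hf z ?_
  by_contra hzA
  refine hz (ContinuousMap.mem_setOfIdeal.2 ?_)
  obtain ⟨u, hu⟩ := (spectrum.notMem_iff.1 hzA).neg
  let R : H →L[ℂ] H := ↑u⁻¹
  have hR : ∀ h, A (R h) - (z : ℂ) • R h = h := by
    intro h
    have h1 : (u : H →L[ℂ] H) * R = 1 := u.mul_inv
    rw [hu] at h1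
    simpa [Algebra.algebraMap_eq_smul_one] using DFunLike.congr_fun h1 h
  let f₀ : C(spectrum ℂ N, ℂ) :=
    ⟨fun w => ((max 0 (1 / 2 - ‖(w : ℂ) - z‖ * ‖R‖) : ℝ) : ℂ), by fun_prop⟩
  refine ⟨f₀, mem_cfcAnnihilator_of_support hN V hV hR f₀ fun w hw => ?_, ?_⟩
  · by_contra! hlt
    refine hw ?_
    change ((max 0 (1 / 2 - ‖(w : ℂ) - z‖ * ‖R‖) : ℝ) : ℂ) = 0
    rw [max_eq_left (by linarith), Complex.ofReal_zero]
  · change ((max 0 (1 / 2 - ‖(z : ℂ) - z‖ * ‖R‖) : ℝ) : ℂ) ≠ 0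
    norm_num

/-- If the normal operator `N` extends `A` and `F` is nonnegative on the spectrum of `A`, then
`F(N)` has nonnegative quadratic form on the space on which `A` acts. -/
theorem inner_cfcHom_nonneg {A : H →L[ℂ] H} {N : K →L[ℂ] K}
    (hN : IsStarNormal N) (V : H →L[ℂ] K) (hV : ∀ h, N (V h) = V (A h))
    (F : ℂ → ℝ) (hFc : Continuous F) (hF : ∀ w ∈ spectrum ℂ A, 0 ≤ F w) (f : C(spectrum ℂ N, ℂ))
    (hf : ∀ w, f w = F w) (h : H) : 0 ≤ (inner ℂ (V h) (cfcHom hN f (V h))).re := by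
  -- The positive part of F agrees with F on σ(A) and has the form q*q.
  let p : C(spectrum ℂ N, ℂ) := ⟨fun w => ((max 0 (F w) : ℝ) : ℂ), by fun_prop⟩
  let q : C(spectrum ℂ N, ℂ) := ⟨fun w => (Real.sqrt (max 0 (F w)) : ℂ), by fun_prop⟩
  have hp : p = star q * q := by
    ext w
    change ((max 0 (F w) : ℝ) : ℂ)
      = conj (Real.sqrt (max 0 (F w)) : ℂ) * (Real.sqrt (max 0 (F w)) : ℂ)
    rw [Complex.conj_ofReal, ← Complex.ofReal_mul, Real.mul_self_sqrt (le_max_left _ _)]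
  have hfp : cfcHom hN f (V h) = cfcHom hN p (V h) := by
    have := mem_cfcAnnihilator_of_eqOn_spectrum hN V hV (f - p) (fun w hw => by
      rw [ContinuousMap.sub_apply, hf]
      change (F w : ℂ) - ((max 0 (F w) : ℝ) : ℂ) = 0
      rw [max_eq_right (hF w hw), sub_self]) h
    rwa [map_sub, sub_apply, sub_eq_zero] at this
  rw [hfp, hp, map_mul, map_star, mul_apply_eq_comp,
    ContinuousLinearMap.star_eq_adjoint, ContinuousLinearMap.adjoint_inner_right]
  exact inner_self_nonneg (𝕜 := ℂ)

/-- The separating function involves only 1, w, w̄ and |w|², whose quadratic forms on the range of V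
are computed from A alone. -/
theorem maximalNumericalRange_subset_of_normal_extension [CompleteSpace H] {A : H →L[ℂ] H}
    {N : K →L[ℂ] K} (hN : IsStarNormal N) (V : H →ₗᵢ[ℂ] K) (hV : ∀ h, N (V h) = V (A h)) :
    maximalNumericalRange A ⊆ convexHull ℝ (spectrum ℂ A ∩ normCircle A) := by
  rintro l ⟨x, hx, hAx, hl⟩
  by_contra hnot
  have hcompact : IsCompact (spectrum ℂ A ∩ normCircle A) :=
    (spectrum.isCompact A).inter_right (isClosed_eq continuous_norm continuous_const)
  obtain ⟨φ, u, hφl, hφ⟩ := geometric_hahn_banach_point_closed (convex_convexHull ℝ _)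
    hcompact.convexHull_of_finiteDimensional.isClosed hnot
  obtain ⟨a, ha⟩ : ∃ a : ℂ, ∀ w, φ w = (a * w).re := by
    refine ⟨φ 1 - φ Complex.I * Complex.I, fun w => ?_⟩
    have : w = w.re • (1 : ℂ) + w.im • Complex.I := by simp
    conv_lhs => rw [this]
    rw [map_add, map_smul, map_smul]
    simp
    ring
  -- The part of σ(A) where φ ≤ u is compact and misses the circle, so (u - φ)/(‖A‖² - |w|²) is
  -- bounded there; M is such a bound.
  obtain ⟨M, hM0, hM⟩ : ∃ M : ℝ, 0 ≤ M ∧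
      ∀ w ∈ spectrum ℂ A, 0 ≤ M * (‖A‖ ^ 2 - ‖w‖ ^ 2) + φ w - u := by
    have hT : IsCompact (spectrum ℂ A ∩ {w | φ w ≤ u}) :=
      (spectrum.isCompact A).inter_right (isClosed_le φ.continuous continuous_const)
    have hle : ∀ w ∈ spectrum ℂ A, ‖w‖ ≤ ‖A‖ := fun w hw => by
      simpa using (spectrum.norm_le_norm_mul_of_mem hw).trans
        (mul_le_of_le_one_right (norm_nonneg A) ContinuousLinearMap.norm_id_le)
    have hpos : ∀ w ∈ spectrum ℂ A ∩ {w | φ w ≤ u}, 0 < ‖A‖ ^ 2 - ‖w‖ ^ 2 := by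
      rintro w ⟨hw, hwu⟩
      have hne : ‖w‖ ≠ ‖A‖ := fun h =>
        (hφ w (subset_convexHull ℝ _ ⟨hw, h⟩)).not_ge hwu
      have := (hle w hw).lt_of_ne hne
      have := norm_nonneg w
      nlinarith
    obtain ⟨C, hC⟩ := hT.exists_bound_of_continuousOn
      (f := fun w => (u - φ w) / (‖A‖ ^ 2 - ‖w‖ ^ 2))
      (ContinuousOn.div (by fun_prop) (by fun_prop) fun w hw => (hpos w hw).ne')
    refine ⟨max 0 C, le_max_left _ _, fun w hw => ?_⟩
    by_cases hwu : φ w ≤ u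
    · have h1 := (le_abs_self _).trans ((hC w ⟨hw, hwu⟩).trans (le_max_right 0 C))
      rw [div_le_iff₀ (hpos w ⟨hw, hwu⟩)] at h1
      linarith
    · have h1 : ‖w‖ ^ 2 ≤ ‖A‖ ^ 2 := by have := hle w hw; gcongr
      have h2 : 0 ≤ max 0 C * (‖A‖ ^ 2 - ‖w‖ ^ 2) :=
        mul_nonneg (le_max_left _ _) (by linarith)
      linarith
  let i : C(spectrum ℂ N, ℂ) := (ContinuousMap.id ℂ).restrict (spectrum ℂ N)
  let c : ℂ := (M * ‖A‖ ^ 2 - u : ℝ)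
  let b : ℂ := (1 / 2 : ℝ)
  let f : C(spectrum ℂ N, ℂ) :=
    c • 1 - (M : ℂ) • (star i * i) + b • (a • i + star (a • i))
  have hf : ∀ w, f w = ((M * (‖A‖ ^ 2 - ‖(w : ℂ)‖ ^ 2) + φ w - u : ℝ) : ℂ) := by
    intro w
    change c * 1 - M * (conj (w : ℂ) * w) + b * (a * w + conj (a * (w : ℂ))) = _
    rw [RCLike.conj_mul, Complex.add_conj, ha]
    simp only [c, b]
    push_cast
    simp
    ring
  have hform : ∀ h, (inner ℂ (V h) (cfcHom hN f (V h))).re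
      = (M * ‖A‖ ^ 2 - u) * ‖h‖ ^ 2 - M * ‖A h‖ ^ 2 + (a * inner ℂ h (A h)).re := by
    intro h
    have hi : cfcHom hN i = N := cfcHom_id hN
    have h1 : inner ℂ (V h) (V h) = ((‖h‖ ^ 2 : ℝ) : ℂ) := by
      rw [V.inner_map_map, inner_self_eq_norm_sq_to_K]; simp
    have h2 : inner ℂ (V (A h)) (V (A h)) = ((‖A h‖ ^ 2 : ℝ) : ℂ) := by
      rw [V.inner_map_map, inner_self_eq_norm_sq_to_K]; simp
    have h3 : inner ℂ (V h) (cfcHom hN f (V h)) = c * inner ℂ (V h) (V h)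
        - M * inner ℂ (V (A h)) (V (A h))
        + b * (a * inner ℂ h (A h) + conj (a * inner ℂ h (A h))) := by
      simp only [f, map_add, map_sub, map_smul, map_mul, map_star, map_one, hi,
        add_apply, sub_apply,
        smul_apply, mul_apply_eq_comp,
        one_apply_eq_self, inner_add_right, inner_sub_right, inner_smul_right,
        star_smul, ContinuousLinearMap.star_eq_adjoint, ContinuousLinearMap.adjoint_inner_right,
        hV, V.inner_map_map, inner_conj_symm]
      rfl
    rw [h3, h1, h2, Complex.add_conj]
    simp only [c, b, ← Complex.ofReal_mul, ← Complex.ofReal_sub, ← Complex.ofReal_add,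
      Complex.ofReal_re]
    ring
  have hnonneg : ∀ n, 0 ≤ (M * ‖A‖ ^ 2 - u) - M * ‖A (x n)‖ ^ 2
      + (a * inner ℂ (x n) (A (x n))).re := by
    intro n
    have := inner_cfcHom_nonneg hN V.toContinuousLinearMap hV
      (fun w => M * (‖A‖ ^ 2 - ‖w‖ ^ 2) + φ w - u) (by fun_prop) hM f hf (x n)
    rw [LinearIsometry.coe_toContinuousLinearMap, hform, hx n] at this
    simpa using this
  -- As ‖A xₙ‖ → ‖A‖, the terms with M cancel, leaving φ l - u ≥ 0.
  have hlim := ((tendsto_const_nhds (x := M * ‖A‖ ^ 2 - u)).sub ((hAx.pow 2).const_mul M)).add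
    ((Complex.continuous_re.tendsto _).comp (hl.const_mul a))
  have := ge_of_tendsto' hlim hnonneg
  rw [← ha] at this
  linarith

end NormalExtension

theorem mainTheorem4 {H : Type u} [NormedAddCommGroup H] [InnerProductSpace ℂ H]
    [CompleteSpace H] (A : H →L[ℂ] H) (hA : IsSubnormal.{u, v} A) :
    maximalNumericalRange A = convexHull ℝ (spectrum ℂ A ∩ normCircle A) := by
  obtain ⟨G, _, _, _, B, C, hN⟩ := hA
  refine Set.Subset.antisymm ?_ (convexHull_spectrum_inter_normCircle_subset A)
  let V : H →ₗᵢ[ℂ] WithLp 2 (H × G) :=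
    { toFun := fun h => WithLp.toLp 2 (h, 0)
      map_add' := fun x y => by simp [← WithLp.toLp_add]
      map_smul' := fun c x => by simp [← WithLp.toLp_smul]
      norm_map' := fun x => by simp }
  refine maximalNumericalRange_subset_of_normal_extension hN V fun h => ?_
  rw [upperBlockOperator_apply]
  simp [V]
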